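/- **Theorem.** Let $W=(W_t)_{t\ge 0}$ be a standard $d$-dimensional Brownian motion on a probability space $(\Omega,\mathcal F,P)$, let $T\ge 0$, and let $\mathcal F_T=\sigma(W_s : s\le T)$. For $h\in L^2([0,T];\mathbb R^d)$ let $\int_0^T h(s)\cdot dW_s$ denote the Wiener integral, i.e. the $L^2(P)$-limit of the elementary integrals $\sum_j a_j\cdot(W_{t_{j+1}}-W_{t_j})$ of deterministic step functions $\sum_j a_j 1_{(t_j,t_{j+1}]}$ (with $0\le t_0\le\dots\le t_n\le T$, $a_j\in\mathbb R^d$) that converge to $h$ in $L^2([0,T];\mathbb R^d)$. Then for every such $h$ this integral exists and is unique up to $P$-null sets, the random variable $$X_T^h=\exp\Big(\int_0^T h(s)\cdot dW_s-\tfrac12\int_0^T |h(s)|^2\,ds\Big)$$ belongs to $L^2(\mathcal F_T,P)$, and the linear span of $$\Psi=\{X_T^h : h\in L^2([0,T];\mathbb R^d)\}$$ is dense in the real Hilbert space $L^2(\mathcal F_T,P)$ (viewed as the closed subspace of $L^2(P)$ consisting of the classes that have an $\mathcal F_T$-measurable representative). -/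

import Mathlib

open MeasureTheory ProbabilityTheory Filter Topology
open scoped NNReal ENNReal

/-- `W` is a standard `d`-dimensional Brownian motion (started at `0` almost surely) under `P`:
its coordinates are independent real Brownian motions. -/
structure IsBrownianMotion {Ω : Type*} [MeasurableSpace Ω] {d : ℕ}
    (W : ℝ≥0 → Ω → EuclideanSpace ℝ (Fin d)) (P : Measure Ω) : Prop where
  measurable : ∀ t, Measurable (W t)
  isBrownianReal : ∀ i, IsBrownianReal (fun t ω ↦ W t ω i) P
  iIndepFun : iIndepFun (fun (i : Fin d) (ω : Ω) (t : ℝ≥0) ↦ W t ω i) P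

/-- The filtration generated by `W`: the member at time `t` is `σ(W s, s ≤ t)`. -/
noncomputable def IsBrownianMotion.filtration {Ω : Type*} [mΩ : MeasurableSpace Ω] {d : ℕ}
    {W : ℝ≥0 → Ω → EuclideanSpace ℝ (Fin d)} {P : Measure Ω} (hW : IsBrownianMotion W P) :
    Filtration ℝ≥0 mΩ :=
  Filtration.natural W fun t ↦ (hW.measurable t).stronglyMeasurable

/-- The space `L²([0,T]; ℝᵈ)` with respect to Lebesgue measure. -/
abbrev TimeL2 (d : ℕ) (T : ℝ≥0) : Type :=
  Lp (EuclideanSpace ℝ (Fin d)) 2 (volume.restrict (Set.Icc (0 : ℝ) T))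

/-- A deterministic step function on `[0,T]` with values in `ℝᵈ`: times
`t 0 ≤ t 1 ≤ ⋯ ≤ t n ≤ T` and a value `a j` on each interval `(t j, t (j + 1)]`. -/
structure WienerStep (d : ℕ) (T : ℝ≥0) where
  n : ℕ
  t : Fin (n + 1) → ℝ≥0
  mono : Monotone t
  le : ∀ j, t j ≤ T
  a : Fin n → EuclideanSpace ℝ (Fin d)

/-- The function `∑ j, a j • 𝟙_{(t j, t (j + 1)]}`. -/
noncomputable def WienerStep.toFun {d : ℕ} {T : ℝ≥0} (φ : WienerStep d T) (s : ℝ) :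
    EuclideanSpace ℝ (Fin d) :=
  ∑ j, (Set.Ioc (φ.t j.castSucc : ℝ) (φ.t j.succ : ℝ)).indicator (fun _ ↦ φ.a j) s

/-- The elementary integral `∑ j, ⟪a j, W (t (j + 1)) - W (t j)⟫`. -/
noncomputable def WienerStep.integral {Ω : Type*} {d : ℕ} {T : ℝ≥0} (φ : WienerStep d T)
    (W : ℝ≥0 → Ω → EuclideanSpace ℝ (Fin d)) (ω : Ω) : ℝ :=
  ∑ j, inner ℝ (φ.a j) (W (φ.t j.succ) ω - W (φ.t j.castSucc) ω)

/-- `I = ∫₀ᵀ h(s) · dW(s)` (Wiener integral): `I` is the limit in `L²(P)` of the elementary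
integrals of some sequence of step functions converging to `h` in `L²([0,T]; ℝᵈ)`. -/
def IsWienerIntegral {Ω : Type*} [MeasurableSpace Ω] {d : ℕ} {T : ℝ≥0}
    (W : ℝ≥0 → Ω → EuclideanSpace ℝ (Fin d)) (P : Measure Ω)
    (h : TimeL2 d T) (I : Lp ℝ 2 P) : Prop :=
  ∃ φ : ℕ → WienerStep d T,
    Tendsto (fun k ↦ eLpNorm (fun s ↦ (φ k).toFun s - h s) 2
      (volume.restrict (Set.Icc (0 : ℝ) T))) atTop (𝓝 0) ∧
    Tendsto (fun k ↦ eLpNorm (fun ω ↦ (φ k).integral W ω - I ω) 2 P) atTop (𝓝 0)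

/-- The random variable `exp (I - ½ ∫₀ᵀ |h(s)|² ds)`. -/
noncomputable def stochExp {Ω : Type*} [MeasurableSpace Ω] {d : ℕ} {T : ℝ≥0} {P : Measure Ω}
    (h : TimeL2 d T) (I : Lp ℝ 2 P) (ω : Ω) : ℝ :=
  Real.exp (I ω - 1 / 2 * ∫ s in Set.Icc (0 : ℝ) T, ‖h s‖ ^ 2)

/-- The set `Ψ` of all `exp (∫₀ᵀ h · dW - ½ ∫₀ᵀ |h|² ds)`, `h ∈ L²([0,T]; ℝᵈ)`,
as elements of `L²(P)`. -/
def stochExpSet {Ω : Type*} [MeasurableSpace Ω] {d : ℕ}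
    (W : ℝ≥0 → Ω → EuclideanSpace ℝ (Fin d)) (P : Measure Ω) (T : ℝ≥0) : Set (Lp ℝ 2 P) :=
  {X | ∃ (h : TimeL2 d T) (I : Lp ℝ 2 P), IsWienerIntegral W P h I ∧ X =ᵐ[P] stochExp h I}

/-! The covariance of the coordinates `W s i`, `W t j` is `min s t` if `i = j` and `0` otherwise,
which is also the `L²([0,T]; ℝᵈ)` inner product of `𝟙_{(0,s]} eᵢ` and `𝟙_{(0,t]} eⱼ`. Matching these
vectors extends to a linear isometry `wienerMap`; as step functions are dense, it is the Wiener
integral (`isWienerIntegral_iff`). A finite combination `X` of coordinates is centred Gaussian, so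
`E exp (2X) = exp (2‖X‖²)`, and Fatou carries the bound to all integrals.

For density, let `Y` in `L²(F_T)` be orthogonal to `Ψ`. Every linear functional of finitely many `W
t`, `t ≤ T`, is a Wiener integral, so `Y` is orthogonal to its exponential. Hence the finite
measures `Y⁺ P` and `Y⁻ P` give these functionals the same finite moment-generating functions.
Analytic continuation gives equal characteristic functions, so equal laws of the path `(W t)_{t ≤
T}`; thus `Y` integrates to `0` over every set of `F_T`, and `Y = 0`. -/

/-! ### Gaussian computations. -/

namespace IsBrownianMotion

variable {Ω : Type*} [MeasurableSpace Ω] {P : Measure Ω} {d : ℕ}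
  {W : ℝ≥0 → Ω → EuclideanSpace ℝ (Fin d)}

/-- The coordinates of a Brownian motion, indexed by coordinate and time, form a Gaussian
process. -/
lemma isGaussianProcess (hW : IsBrownianMotion W P) [IsProbabilityMeasure P] :
    IsGaussianProcess (fun (p : Fin d × ℝ≥0) ω ↦ W p.2 ω p.1) P where
  hasGaussianLaw I := by
    classical
    -- Enlarging `I` to the rectangle `Fin d × J` gives independent Gaussian blocks, which are
    -- jointly Gaussian; `I` is a projection of it.
    let J : Finset ℝ≥0 := I.image Prod.snd
    have h1 : HasGaussianLaw (fun ω (i : Fin d) (t : J) ↦ W t ω i) P := by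
      refine iIndepFun.hasGaussianLaw (X := fun (i : Fin d) ω (t : J) ↦ W t ω i)
        (fun i ↦ (IsPreBrownianReal.isGaussianProcess (hW.isBrownianReal i).1).hasGaussianLaw J) ?_
      exact hW.iIndepFun.comp (fun _ x (t : J) ↦ x t) (fun _ ↦ by fun_prop)
    let L : (Fin d → J → ℝ) →L[ℝ] (I → ℝ) := ContinuousLinearMap.pi fun p : I ↦
      (ContinuousLinearMap.proj (R := ℝ) (φ := fun _ : J ↦ ℝ)
        ⟨p.1.2, Finset.mem_image_of_mem _ p.2⟩).comp
        (ContinuousLinearMap.proj (R := ℝ) (φ := fun _ : Fin d ↦ J → ℝ) p.1.1)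
    exact h1.map L

lemma memLp_two_eval (hW : IsBrownianMotion W P) (i : Fin d) (t : ℝ≥0) :
    MemLp (fun ω ↦ W t ω i) 2 P :=
  ((IsPreBrownianReal.isGaussianProcess (hW.isBrownianReal i).1).hasGaussianLaw_eval t).memLp_two

lemma integral_eval (hW : IsBrownianMotion W P) (i : Fin d) (t : ℝ≥0) :
    ∫ ω, W t ω i ∂P = 0 :=
  (hW.isBrownianReal i).integral_eval t

lemma integral_eval_mul_eval (hW : IsBrownianMotion W P) [IsProbabilityMeasure P]
    (i j : Fin d) (s t : ℝ≥0) :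
    ∫ ω, W s ω i * W t ω j ∂P = if i = j then ((min s t : ℝ≥0) : ℝ) else 0 := by
  split_ifs with hij
  · subst hij
    have := (hW.isBrownianReal i).covariance_fun_eval s t
    rw [covariance_eq_sub (hW.memLp_two_eval i s) (hW.memLp_two_eval i t), hW.integral_eval,
      zero_mul, sub_zero] at this
    simpa using this
  · have h : IndepFun (fun ω ↦ W s ω i) (fun ω ↦ W t ω j) P :=
      (hW.iIndepFun.indepFun hij).comp (φ := fun x : ℝ≥0 → ℝ ↦ x s)
        (ψ := fun x : ℝ≥0 → ℝ ↦ x t)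
        (measurable_pi_apply s) (measurable_pi_apply t)
    rw [h.integral_fun_mul_eq_mul_integral (hW.memLp_two_eval i s).aestronglyMeasurable
      (hW.memLp_two_eval j t).aestronglyMeasurable, hW.integral_eval, zero_mul]

/-- The exponential moment of a finite linear combination of Brownian coordinates. -/
lemma lintegral_exp_sum (hW : IsBrownianMotion W P) [IsProbabilityMeasure P]
    {ι : Type*} (I : Finset ι) (c : ι → ℝ) (q : ι → Fin d × ℝ≥0) :
    ∫⁻ ω, ENNReal.ofReal (Real.exp (2 * ∑ p ∈ I, c p * W (q p).2 ω (q p).1)) ∂P =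
      ENNReal.ofReal (Real.exp (2 * ∫ ω, (∑ p ∈ I, c p * W (q p).2 ω (q p).1) ^ 2 ∂P)) := by
  set X : Ω → ℝ := fun ω ↦ ∑ p ∈ I, c p * W (q p).2 ω (q p).1 with hX
  have hG : HasGaussianLaw X P :=
    ((hW.isGaussianProcess.comp_right q).smul c).hasGaussianLaw_fun_sum
  have h0 : ∫ ω, X ω ∂P = 0 := by
    simp only [hX]
    rw [integral_finsetSum _ fun p _ ↦
      ((hW.memLp_two_eval (q p).1 (q p).2).integrable one_le_two).const_mul _]
    simp [integral_const_mul, hW.integral_eval]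
  have hV : Var[X; P] = ∫ ω, X ω ^ 2 ∂P := by
    rw [variance_of_integral_eq_zero hG.aemeasurable h0]
  have hmap := hG.map_eq_gaussianReal
  have hmgf := mgf_gaussianReal hmap 2
  have hint : Integrable (fun ω ↦ Real.exp (2 * X ω)) P := by
    -- A non-integrable exponential would give `mgf` its default value `0`.
    rw [← mgf_pos_iff, hmgf]; positivity
  rw [← ofReal_integral_eq_lintegral_ofReal hint (by filter_upwards with ω; positivity)]
  have : mgf X P 2 = ∫ ω, Real.exp (2 * X ω) ∂P := rfl
  rw [← this, hmgf, h0, hV]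
  congr 2
  rw [Real.coe_toNNReal _ (integral_nonneg fun _ ↦ sq_nonneg _)]
  ring

end IsBrownianMotion

/-- **Fatou's lemma** for exponentials of an `L²`-convergent sequence. -/
lemma MeasureTheory.Lp.lintegral_exp_le_of_tendsto {Ω : Type*} [MeasurableSpace Ω]
    {P : Measure Ω} {f : ℕ → Lp ℝ 2 P} {g : Lp ℝ 2 P} (hf : Tendsto f atTop (𝓝 g)) {C : ℝ≥0∞}
    (hC : ∀ k, ∫⁻ ω, ENNReal.ofReal (Real.exp (2 * f k ω)) ∂P ≤ C) :
    ∫⁻ ω, ENNReal.ofReal (Real.exp (2 * g ω)) ∂P ≤ C := by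
  obtain ⟨ns, -, hns⟩ := (tendstoInMeasure_of_tendsto_Lp hf).exists_seq_tendsto_ae
  have hae : ∀ᵐ ω ∂P, ENNReal.ofReal (Real.exp (2 * g ω)) ≤
      liminf (fun k ↦ ENNReal.ofReal (Real.exp (2 * f (ns k) ω))) atTop := by
    filter_upwards [hns] with ω hω
    refine le_of_eq (Tendsto.liminf_eq ?_).symm
    exact ENNReal.tendsto_ofReal ((Real.continuous_exp.tendsto _).comp (hω.const_mul 2))
  refine (lintegral_mono_ae hae).trans ((lintegral_liminf_le' fun k ↦ ?_).trans ?_)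
  · exact ((Real.measurable_exp.comp_aemeasurable
      ((Lp.aestronglyMeasurable _).aemeasurable.const_mul 2))).ennreal_ofReal
  · refine liminf_le_of_frequently_le' (Frequently.of_forall fun k ↦ hC _)

/-! ### Step functions and their density in `L²([0,T]; ℝᵈ)`. -/

namespace TimeL2

/-- The element `𝟙_{(0, t]} eᵢ` of `L²([0,T]; ℝᵈ)`. -/
noncomputable def atom {d : ℕ} (T : ℝ≥0) (i : Fin d) (t : ℝ≥0) : TimeL2 d T :=
  indicatorConstLp 2 (measurableSet_Ioc (a := (0 : ℝ)) (b := t)) (measure_ne_top _ _)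
    (EuclideanSpace.single i 1)

lemma inner_atom {d : ℕ} {T s t : ℝ≥0} (hs : s ≤ T) (ht : t ≤ T) (i j : Fin d) :
    inner ℝ (atom T i s) (atom T j t) = if i = j then ((min s t : ℝ≥0) : ℝ) else 0 := by
  have h : Set.Ioc (0 : ℝ) s ∩ Set.Ioc 0 t ∩ Set.Icc (0 : ℝ) T =
      Set.Ioc (0 : ℝ) ((min s t : ℝ≥0) : ℝ) := by
    have hs' : (s : ℝ) ≤ T := hs
    have ht' : (t : ℝ) ≤ T := ht
    ext x
    simp only [Set.mem_inter_iff, Set.mem_Ioc, Set.mem_Icc, NNReal.coe_min, le_min_iff]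
    constructor
    · rintro ⟨⟨⟨h0, h1⟩, -, h2⟩, -⟩
      exact ⟨h0, h1, h2⟩
    · rintro ⟨h0, h1, h2⟩
      exact ⟨⟨⟨h0, h1⟩, h0, h2⟩, h0.le, h1.trans hs'⟩
  rw [atom, atom, L2.inner_indicatorConstLp_indicatorConstLp, measureReal_def,
    Measure.restrict_apply (measurableSet_Ioc.inter measurableSet_Ioc), h, Real.volume_Ioc]
  simp only [sub_zero, EuclideanSpace.inner_single_left]
  rcases eq_or_ne i j with rfl | hij
  · simp [ENNReal.toReal_ofReal, -ENNReal.ofReal_min]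
  · simp [hij]

lemma atom_coeFn {d : ℕ} (T : ℝ≥0) (i : Fin d) (t : ℝ≥0) :
    atom T i t =ᵐ[volume.restrict (Set.Icc (0 : ℝ) T)]
      (Set.Ioc (0 : ℝ) t).indicator fun _ ↦ EuclideanSpace.single i 1 :=
  indicatorConstLp_coeFn

end TimeL2

/-- Serves both sides of the isometry: step functions in time and elementary integrals on `Ω`. -/
lemma MeasureTheory.Lp.coeFn_sum_smul_sub {α E : Type*} {mα : MeasurableSpace α} {μ : Measure α}
    [NormedAddCommGroup E] [NormedSpace ℝ E] {p : ℝ≥0∞} {n d : ℕ}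
    (g : Fin d → Fin (n + 1) → Lp E p μ) (G : Fin d → Fin (n + 1) → α → E)
    (h : ∀ i j, g i j =ᵐ[μ] G i j) (a : Fin n → Fin d → ℝ) :
    ⇑(∑ j, ∑ i, a j i • (g i j.succ - g i j.castSucc)) =ᵐ[μ]
      fun x ↦ ∑ j, ∑ i, a j i • (G i j.succ x - G i j.castSucc x) := by
  have h1 : ∀ᵐ x ∂μ, ∀ j i, (a j i • (g i j.succ - g i j.castSucc) : Lp E p μ) x =
      a j i • (G i j.succ x - G i j.castSucc x) := by
    refine ae_all_iff.2 fun j ↦ ae_all_iff.2 fun i ↦ ?_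
    filter_upwards [Lp.coeFn_smul (a j i) (g i j.succ - g i j.castSucc),
      Lp.coeFn_sub (g i j.succ) (g i j.castSucc), h i j.succ, h i j.castSucc] with x h1 h2 h3 h4
    rw [h1, Pi.smul_apply, h2, Pi.sub_apply, h3, h4]
  have h2 : ∀ᵐ x ∂μ, ∀ j, (∑ i, a j i • (g i j.succ - g i j.castSucc) : Lp E p μ) x =
      ∑ i, (a j i • (g i j.succ - g i j.castSucc) : Lp E p μ) x :=
    ae_all_iff.2 fun j ↦ Lp.coeFn_fun_finsetSum _ _
  filter_upwards [Lp.coeFn_fun_finsetSum Finset.univ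
    fun j ↦ ∑ i, a j i • (g i j.succ - g i j.castSucc), h1, h2] with x h3 h1 h2
  simp only [h3, h2, h1]

namespace WienerStep

variable {d : ℕ} {T : ℝ≥0}

/-- The class of a step function in `L²([0,T]; ℝᵈ)`, as a combination of the `TimeL2.atom`s. -/
noncomputable def toTimeL2 (φ : WienerStep d T) : TimeL2 d T :=
  ∑ j, ∑ i, φ.a j i • (TimeL2.atom T i (φ.t j.succ) - TimeL2.atom T i (φ.t j.castSucc))

lemma toTimeL2_coeFn (φ : WienerStep d T) :
    φ.toTimeL2 =ᵐ[volume.restrict (Set.Icc (0 : ℝ) T)] φ.toFun := by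
  refine (Lp.coeFn_sum_smul_sub _ _ (fun i j ↦ TimeL2.atom_coeFn T i (φ.t j)) _).trans
    (Eventually.of_forall fun s ↦ Finset.sum_congr rfl fun j _ ↦ ?_)
  have hle : (φ.t j.castSucc : ℝ) ≤ φ.t j.succ := φ.mono (Fin.castSucc_le_succ j)
  have h0 : (0 : ℝ) ≤ φ.t j.castSucc := NNReal.coe_nonneg _
  have hsum : ∑ i, φ.a j i • EuclideanSpace.single i (1 : ℝ) = φ.a j := by
    ext k
    simp [Finset.sum_apply, Pi.single_apply]
  by_cases h1 : s ∈ Set.Ioc (φ.t j.castSucc : ℝ) (φ.t j.succ : ℝ)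
  · have h2 : s ∈ Set.Ioc (0 : ℝ) (φ.t j.succ) := ⟨h0.trans_lt h1.1, h1.2⟩
    have h3 : s ∉ Set.Ioc (0 : ℝ) (φ.t j.castSucc) := fun h ↦ absurd h1.1 h.2.not_gt
    simp only [Set.indicator_of_mem h1, Set.indicator_of_mem h2, Set.indicator_of_notMem h3,
      sub_zero, hsum]
  · rw [Set.indicator_of_notMem h1]
    refine Finset.sum_eq_zero fun i _ ↦ ?_
    by_cases h2 : s ∈ Set.Ioc (0 : ℝ) (φ.t j.castSucc)
    · have h3 : s ∈ Set.Ioc (0 : ℝ) (φ.t j.succ) := ⟨h2.1, h2.2.trans hle⟩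
      simp [Set.indicator_of_mem h2, Set.indicator_of_mem h3]
    · have h3 : s ∉ Set.Ioc (0 : ℝ) (φ.t j.succ) := fun h ↦
        h1 ⟨not_le.1 fun h' ↦ h2 ⟨h.1, h'⟩, h.2⟩
      simp [Set.indicator_of_notMem h2, Set.indicator_of_notMem h3]

lemma toFun_eq_of_mem (φ : WienerStep d T) {s : ℝ} {j : Fin φ.n}
    (hs : s ∈ Set.Ioc (φ.t j.castSucc : ℝ) (φ.t j.succ : ℝ)) : φ.toFun s = φ.a j := by
  rw [toFun, Finset.sum_eq_single j, Set.indicator_of_mem hs]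
  · intro k _ hkj
    refine Set.indicator_of_notMem (fun hk ↦ ?_) _
    rcases lt_or_gt_of_ne hkj with h | h
    · have : (φ.t k.succ : ℝ) ≤ φ.t j.castSucc := φ.mono (Fin.succ_le_castSucc_iff.2 h)
      exact absurd (hk.2.trans this) hs.1.not_ge
    · have : (φ.t j.succ : ℝ) ≤ φ.t k.castSucc := φ.mono (Fin.succ_le_castSucc_iff.2 h)
      exact absurd (hs.2.trans this) hk.1.not_ge
  · simp

lemma exists_mem_Ioc (φ : WienerStep d T) {s : ℝ} (h0 : (φ.t 0 : ℝ) < s)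
    (hs : s ≤ φ.t (Fin.last φ.n)) :
    ∃ j : Fin φ.n, s ∈ Set.Ioc (φ.t j.castSucc : ℝ) (φ.t j.succ : ℝ) := by
  have key : ∀ k : Fin (φ.n + 1), s ≤ φ.t k →
      ∃ j : Fin φ.n, s ∈ Set.Ioc (φ.t j.castSucc : ℝ) (φ.t j.succ : ℝ) := by
    intro k
    induction k using Fin.induction with
    | zero => exact fun h ↦ absurd h h0.not_ge
    | succ k ih =>
      intro h
      by_cases h' : s ≤ φ.t k.castSucc
      · exact ih h'
      · exact ⟨k, not_le.1 h', h⟩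
  exact key _ hs

/-- The step function on the uniform partition of `[0, T]` into `N` intervals which takes
the value of `g` at the right endpoint of each interval. -/
noncomputable def uniform (T : ℝ≥0) (g : ℝ → EuclideanSpace ℝ (Fin d)) (N : ℕ) :
    WienerStep d T where
  n := N
  t j := (j : ℕ) / N * T
  mono i j h := by
    have : ((i : ℕ) : ℝ≥0) ≤ (j : ℕ) := by exact_mod_cast h
    dsimp only
    gcongr
  le j := by
    refine mul_le_of_le_one_left (zero_le) (div_le_one_of_le₀ ?_ (zero_le))
    exact_mod_cast Fin.is_le j
  a j := g (((j : ℕ) + 1) / N * T)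

lemma norm_uniform_sub_le {g : ℝ → EuclideanSpace ℝ (Fin d)} {ε δ : ℝ}
    (hg : ∀ x y, dist x y < δ → dist (g x) (g y) < ε) {N : ℕ} (hN : 0 < N) (hTN : T / N < δ)
    {s : ℝ} (hs : s ∈ Set.Ioc (0 : ℝ) T) : ‖(uniform T g N).toFun s - g s‖ ≤ ε := by
  have hN' : (N : ℝ) ≠ 0 := by positivity
  obtain ⟨j, hj⟩ := (uniform T g N).exists_mem_Ioc (s := s) (by simpa [uniform] using hs.1)
    (by simpa [uniform, hN'] using hs.2)
  rw [toFun_eq_of_mem _ hj, ← dist_eq_norm]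
  refine (hg _ _ ?_).le
  refine lt_of_le_of_lt ?_ hTN
  have h1 : ((j : ℕ) : ℝ) / N * T < s := hj.1
  have h2 : s ≤ (((j : ℕ) : ℝ) + 1) / N * T := by
    have : s ≤ (((j : ℕ) + 1 : ℕ) : ℝ) / N * T := hj.2
    rwa [Nat.cast_add_one] at this
  rw [Real.dist_eq, abs_of_nonneg (by linarith)]
  have : (((j : ℕ) : ℝ) + 1) / N * T = ((j : ℕ) : ℝ) / N * T + T / N := by ring
  linarith

/-- Half of `ε` goes to replacing `h` by a uniformly continuous `g`, half to sampling `g` on a fine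
uniform partition. -/
lemma exists_eLpNorm_sub_le (h : TimeL2 d T) {ε : ℝ≥0∞} (hε : ε ≠ 0) :
    ∃ φ : WienerStep d T,
      eLpNorm (fun s ↦ φ.toFun s - h s) 2 (volume.restrict (Set.Icc (0 : ℝ) T)) ≤ ε := by
  set μ := volume.restrict (Set.Icc (0 : ℝ) T) with hμ
  obtain ⟨g, hgc, hgh, hgcont, hgL⟩ := (Lp.memLp h).exists_hasCompactSupport_eLpNorm_sub_le
    ENNReal.ofNat_ne_top (ENNReal.half_pos hε).ne'
  have hgu : UniformContinuous g := hgc.uniformContinuous_of_continuous hgcont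
  have hK : μ Set.univ ^ (2 : ℝ≥0∞).toReal⁻¹ ≠ ∞ :=
    ENNReal.rpow_ne_top_of_nonneg (by positivity) (measure_ne_top _ _)
  obtain ⟨c, hc, hcε⟩ := ENNReal.exists_nnreal_pos_mul_lt hK (ENNReal.half_pos hε).ne'
  obtain ⟨δ, hδ, hgδ⟩ := Metric.uniformContinuous_iff.1 hgu c (by exact_mod_cast hc)
  obtain ⟨N, hN⟩ := exists_nat_gt (T / δ : ℝ)
  have hN0 : (0 : ℝ) < N := lt_of_le_of_lt (by positivity) hN
  refine ⟨uniform T g N, ?_⟩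
  have hb : ∀ᵐ s ∂μ, ‖(uniform T g N).toFun s - g s‖ ≤ c := by
    -- The half-open intervals miss the point `0`.
    have h0 : ∀ᵐ s ∂μ, s ≠ 0 := by
      exact ae_restrict_of_ae (Measure.ae_ne volume 0)
    filter_upwards [h0, ae_restrict_mem measurableSet_Icc] with s hs0 hs
    refine norm_uniform_sub_le (fun x y h ↦ hgδ h) (by exact_mod_cast hN0) ?_
      ⟨lt_of_le_of_ne hs.1 hs0.symm, hs.2⟩
    rw [div_lt_iff₀ hN0, mul_comm]
    rwa [div_lt_iff₀ hδ] at hN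
  have h1 := eLpNorm_le_of_ae_bound (p := 2) hb
  rw [ENNReal.ofReal_coe_nnreal, mul_comm] at h1
  have hm : AEStronglyMeasurable (uniform T g N).toFun μ :=
    (Lp.aestronglyMeasurable _).congr (toTimeL2_coeFn _)
  have := eLpNorm_add_le (hm.sub hgL.1) (hgL.1.sub (Lp.aestronglyMeasurable h)) one_le_two
  rw [sub_add_sub_cancel] at this
  refine this.trans ?_
  rw [eLpNorm_sub_comm _ _ _ _] at hgh
  exact (add_le_add (h1.trans hcε.le) hgh).trans_eq (ENNReal.add_halves ε)

lemma eLpNorm_toFun_sub (φ : WienerStep d T) (h : TimeL2 d T) :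
    eLpNorm (fun s ↦ φ.toFun s - h s) 2 (volume.restrict (Set.Icc (0 : ℝ) T)) =
      edist φ.toTimeL2 h := by
  rw [Lp.edist_def]
  refine eLpNorm_congr_ae ?_
  filter_upwards [φ.toTimeL2_coeFn] with s hs
  simp [hs]

lemma exists_seq_tendsto (h : TimeL2 d T) :
    ∃ φ : ℕ → WienerStep d T, Tendsto (fun k ↦ (φ k).toTimeL2) atTop (𝓝 h) := by
  have : h ∈ closure (Set.range (toTimeL2 : WienerStep d T → TimeL2 d T)) := by
    refine EMetric.mem_closure_iff.2 fun ε hε ↦ ?_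
    obtain ⟨δ, hδ, hδε⟩ := exists_between hε
    obtain ⟨φ, hφ⟩ := exists_eLpNorm_sub_le h hδ.ne'
    rw [eLpNorm_toFun_sub, edist_comm] at hφ
    exact ⟨_, ⟨φ, rfl⟩, hφ.trans_lt hδε⟩
  obtain ⟨x, hx, hlim⟩ := mem_closure_iff_seq_limit.1 this
  choose φ hφ using hx
  exact ⟨φ, by simpa only [hφ] using hlim⟩

end WienerStep

/-- Equal Gram matrices give equal norms; no linear independence is needed (the atoms at time `0`
vanish). -/
lemma norm_linearCombination_eq_of_inner_eq {ι H K : Type*} [NormedAddCommGroup H]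
    [InnerProductSpace ℝ H] [NormedAddCommGroup K] [InnerProductSpace ℝ K] {e : ι → H} {f : ι → K}
    (h : ∀ i j, inner ℝ (f i) (f j) = inner ℝ (e i) (e j)) (c : ι →₀ ℝ) :
    ‖Finsupp.linearCombination ℝ f c‖ = ‖Finsupp.linearCombination ℝ e c‖ := by
  rw [← sq_eq_sq₀ (norm_nonneg _) (norm_nonneg _), ← real_inner_self_eq_norm_sq,
    ← real_inner_self_eq_norm_sq]
  simp only [Finsupp.linearCombination_apply, Finsupp.sum, sum_inner, inner_sum, inner_smul_left,
    inner_smul_right, h]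

lemma TimeL2.denseRange_linearCombination_atom (d : ℕ) (T : ℝ≥0) :
    DenseRange (Finsupp.linearCombination ℝ
      fun p : Fin d × Set.Iic T ↦ TimeL2.atom T p.1 (p.2 : ℝ≥0)) := by
  intro h
  obtain ⟨φ, hφ⟩ := WienerStep.exists_seq_tendsto h
  refine mem_closure_of_tendsto hφ (Eventually.of_forall fun k ↦ ?_)
  rw [← LinearMap.coe_range, SetLike.mem_coe, Finsupp.range_linearCombination]
  refine Submodule.sum_mem _ fun j _ ↦ Submodule.sum_mem _ fun i _ ↦
    Submodule.smul_mem _ _ (Submodule.sub_mem _ ?_ ?_)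
  · exact Submodule.subset_span ⟨(i, ⟨_, (φ k).le j.succ⟩), rfl⟩
  · exact Submodule.subset_span ⟨(i, ⟨_, (φ k).le j.castSucc⟩), rfl⟩

/-! ### The Wiener isometry and its exponentials. -/

namespace IsBrownianMotion

variable {Ω : Type*} [MeasurableSpace Ω] {P : Measure Ω} {d : ℕ}
  {W : ℝ≥0 → Ω → EuclideanSpace ℝ (Fin d)}

/-- The value of a coordinate of a Brownian motion at a given time, as an element of `L²(P)`. -/
noncomputable def evalLp (hW : IsBrownianMotion W P) (i : Fin d) (t : ℝ≥0) : Lp ℝ 2 P :=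
  (hW.memLp_two_eval i t).toLp

lemma evalLp_coeFn (hW : IsBrownianMotion W P) (i : Fin d) (t : ℝ≥0) :
    hW.evalLp i t =ᵐ[P] fun ω ↦ W t ω i :=
  MemLp.coeFn_toLp _

lemma inner_evalLp [IsProbabilityMeasure P] (hW : IsBrownianMotion W P) (i j : Fin d)
    (s t : ℝ≥0) :
    inner ℝ (hW.evalLp i s) (hW.evalLp j t) = if i = j then ((min s t : ℝ≥0) : ℝ) else 0 := by
  rw [← hW.integral_eval_mul_eval, L2.inner_def]
  refine integral_congr_ae ?_
  filter_upwards [hW.evalLp_coeFn i s, hW.evalLp_coeFn j t] with ω h1 h2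
  simp [h1, h2, mul_comm]

/-- The Wiener integral as a continuous linear map. -/
noncomputable def wienerMap (hW : IsBrownianMotion W P) (T : ℝ≥0) : TimeL2 d T →L[ℝ] Lp ℝ 2 P :=
  (Finsupp.linearCombination ℝ fun p : Fin d × Set.Iic T ↦ hW.evalLp p.1 p.2).extendOfNorm
    (Finsupp.linearCombination ℝ fun p : Fin d × Set.Iic T ↦ TimeL2.atom T p.1 (p.2 : ℝ≥0))

lemma evalLp_mem_lpMeas (hW : IsBrownianMotion W P) (i : Fin d) {t T : ℝ≥0} (ht : t ≤ T) :
    hW.evalLp i t ∈ lpMeas ℝ ℝ (hW.filtration T) 2 P := by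
  rw [mem_lpMeas_iff_aestronglyMeasurable]
  have h : Measurable[hW.filtration T] (W t) :=
    (Filtration.stronglyAdapted_natural
      fun t ↦ (hW.measurable t).stronglyMeasurable).stronglyMeasurable_le ht |>.measurable
  have h1 : Measurable[hW.filtration T] fun ω ↦ W t ω i :=
    (show Measurable fun x : EuclideanSpace ℝ (Fin d) ↦ x i by fun_prop).comp h
  exact ⟨_, h1.stronglyMeasurable, hW.evalLp_coeFn i t⟩

lemma isClosed_lpMeas (hW : IsBrownianMotion W P) (T : ℝ≥0) :
    IsClosed (lpMeas ℝ ℝ (hW.filtration T) 2 P : Set (Lp ℝ 2 P)) :=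
  isClosed_aestronglyMeasurable (hW.filtration.le T)

lemma filtration_le_comap (hW : IsBrownianMotion W P) (T : ℝ≥0) :
    hW.filtration T ≤ MeasurableSpace.comap (fun ω (t : Set.Iic T) ↦ W t ω) inferInstance := by
  refine iSup₂_le fun t ht ↦ ?_
  rw [← measurable_iff_comap_le]
  exact (measurable_pi_apply (X := fun _ : Set.Iic T ↦ EuclideanSpace ℝ (Fin d)) ⟨t, ht⟩).comp
    (comap_measurable fun ω (t : Set.Iic T) ↦ W t ω)

variable [IsProbabilityMeasure P] {T : ℝ≥0}

lemma wienerMap_linearCombination (hW : IsBrownianMotion W P) (c : Fin d × Set.Iic T →₀ ℝ) :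
    hW.wienerMap T (Finsupp.linearCombination ℝ (fun p ↦ TimeL2.atom T p.1 (p.2 : ℝ≥0)) c) =
      Finsupp.linearCombination ℝ (fun p ↦ hW.evalLp p.1 p.2) c :=
  LinearMap.extendOfNorm_eq (TimeL2.denseRange_linearCombination_atom d T)
    ⟨1, fun c ↦ by
      rw [one_mul, norm_linearCombination_eq_of_inner_eq
        (e := fun p : Fin d × Set.Iic T ↦ TimeL2.atom T p.1 (p.2 : ℝ≥0)) fun p q ↦ ?_]
      rw [hW.inner_evalLp, TimeL2.inner_atom p.2.2 q.2.2]⟩ c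

lemma wienerMap_atom (hW : IsBrownianMotion W P) (i : Fin d) {t : ℝ≥0} (ht : t ≤ T) :
    hW.wienerMap T (TimeL2.atom T i t) = hW.evalLp i t := by
  simpa using hW.wienerMap_linearCombination (Finsupp.single (i, (⟨t, ht⟩ : Set.Iic T)) 1)

lemma wienerMap_toTimeL2 (hW : IsBrownianMotion W P) (φ : WienerStep d T) :
    hW.wienerMap T φ.toTimeL2 =
      ∑ j, ∑ i, φ.a j i • (hW.evalLp i (φ.t j.succ) - hW.evalLp i (φ.t j.castSucc)) := by
  simp only [WienerStep.toTimeL2, map_sum, map_smul, map_sub, hW.wienerMap_atom _ (φ.le _)]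

lemma wienerMap_toTimeL2_coeFn (hW : IsBrownianMotion W P) (φ : WienerStep d T) :
    hW.wienerMap T φ.toTimeL2 =ᵐ[P] φ.integral W := by
  rw [wienerMap_toTimeL2]
  refine (Lp.coeFn_sum_smul_sub _ _ (fun i j ↦ hW.evalLp_coeFn i (φ.t j)) _).trans
    (Eventually.of_forall fun ω ↦ Finset.sum_congr rfl fun j _ ↦ ?_)
  simp [PiLp.inner_apply, mul_comm]

lemma eLpNorm_integral_sub (hW : IsBrownianMotion W P) (φ : WienerStep d T) (I : Lp ℝ 2 P) :
    eLpNorm (fun ω ↦ φ.integral W ω - I ω) 2 P = edist (hW.wienerMap T φ.toTimeL2) I := by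
  rw [Lp.edist_def]
  refine eLpNorm_congr_ae ?_
  filter_upwards [hW.wienerMap_toTimeL2_coeFn φ] with ω hω
  simp [hω]

/-- Continuity of `wienerMap` and uniqueness of limits make the result independent of the
approximating sequence. -/
lemma isWienerIntegral_iff (hW : IsBrownianMotion W P) {h : TimeL2 d T} {I : Lp ℝ 2 P} :
    IsWienerIntegral W P h I ↔ I = hW.wienerMap T h := by
  simp only [IsWienerIntegral, WienerStep.eLpNorm_toFun_sub, hW.eLpNorm_integral_sub,
    ← tendsto_iff_edist_tendsto_0]
  constructor
  · rintro ⟨φ, h1, h2⟩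
    exact tendsto_nhds_unique h2 (((hW.wienerMap T).continuous.tendsto h).comp h1)
  · rintro rfl
    obtain ⟨φ, hφ⟩ := WienerStep.exists_seq_tendsto h
    exact ⟨φ, hφ, ((hW.wienerMap T).continuous.tendsto h).comp hφ⟩

lemma lintegral_exp_linearCombination (hW : IsBrownianMotion W P) (c : Fin d × Set.Iic T →₀ ℝ) :
    ∫⁻ ω, ENNReal.ofReal
      (Real.exp (2 * Finsupp.linearCombination ℝ (fun p ↦ hW.evalLp p.1 p.2) c ω)) ∂P =
      ENNReal.ofReal
        (Real.exp (2 * ‖Finsupp.linearCombination ℝ (fun p ↦ hW.evalLp p.1 p.2) c‖ ^ 2)) := by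
  have hae : Finsupp.linearCombination ℝ (fun p : Fin d × Set.Iic T ↦ hW.evalLp p.1 p.2) c =ᵐ[P]
      fun ω ↦ ∑ p ∈ c.support, c p * W p.2 ω p.1 := by
    rw [Finsupp.linearCombination_apply, Finsupp.sum]
    have h1 : ∀ᵐ ω ∂P, ∀ p ∈ c.support, (c p • hW.evalLp p.1 p.2 : Lp ℝ 2 P) ω =
        c p * W p.2 ω p.1 := by
      refine (Finset.eventually_all _).2 fun p _ ↦ ?_
      filter_upwards [Lp.coeFn_smul (c p) (hW.evalLp p.1 p.2), hW.evalLp_coeFn p.1 p.2]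
        with ω h1 h2
      simp [h1, h2]
    filter_upwards [Lp.coeFn_fun_finsetSum c.support fun p ↦ c p • hW.evalLp p.1 p.2, h1]
      with ω h2 h1
    rw [h2]
    exact Finset.sum_congr rfl h1
  rw [← real_inner_self_eq_norm_sq, L2.inner_def]
  have h2 := hW.lintegral_exp_sum c.support c (fun p ↦ (p.1, (p.2 : ℝ≥0)))
  convert! h2 using 1
  · refine lintegral_congr_ae ?_
    filter_upwards [hae] with ω hω
    rw [hω]
  · congr 3
    refine integral_congr_ae ?_
    filter_upwards [hae] with ω hω
    simp only [hω]
    simp [sq]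

/-- Norms along a convergent sequence are bounded, so Fatou applies with a uniform bound;
Gaussianity of the limit is not needed. -/
lemma lintegral_exp_wienerMap_lt_top (hW : IsBrownianMotion W P) (h : TimeL2 d T) :
    ∫⁻ ω, ENNReal.ofReal (Real.exp (2 * hW.wienerMap T h ω)) ∂P < ∞ := by
  obtain ⟨x, hx, hlim⟩ := mem_closure_iff_seq_limit.1
    (TimeL2.denseRange_linearCombination_atom d T h)
  choose c hc using hx
  have hJ : Tendsto (fun k ↦ hW.wienerMap T (x k)) atTop (𝓝 (hW.wienerMap T h)) :=
    ((hW.wienerMap T).continuous.tendsto h).comp hlim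
  obtain ⟨C, hC⟩ := hJ.norm.bddAbove_range
  refine (Lp.lintegral_exp_le_of_tendsto hJ (C := ENNReal.ofReal (Real.exp (2 * C ^ 2)))
    fun k ↦ ?_).trans_lt ENNReal.ofReal_lt_top
  have hk : ‖hW.wienerMap T (x k)‖ ≤ C := hC ⟨k, rfl⟩
  rw [← hc k, wienerMap_linearCombination] at hk ⊢
  rw [lintegral_exp_linearCombination]
  gcongr

lemma memLp_exp_wienerMap (hW : IsBrownianMotion W P) (h : TimeL2 d T) :
    MemLp (fun ω ↦ Real.exp (hW.wienerMap T h ω)) 2 P := by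
  have hm : AEMeasurable (hW.wienerMap T h) P := (Lp.aestronglyMeasurable _).aemeasurable
  have hm' : AEStronglyMeasurable (fun ω ↦ Real.exp (hW.wienerMap T h ω)) P :=
    (Real.measurable_exp.comp_aemeasurable hm).aestronglyMeasurable
  rw [memLp_two_iff_integrable_sq hm']
  simp only [← Real.exp_nat_mul, Nat.cast_ofNat]
  refine ⟨(Real.measurable_exp.comp_aemeasurable (hm.const_mul 2)).aestronglyMeasurable, ?_⟩
  rw [hasFiniteIntegral_iff_ofReal (Eventually.of_forall fun _ ↦ Real.exp_nonneg _)]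
  exact hW.lintegral_exp_wienerMap_lt_top h

lemma wienerMap_mem_lpMeas (hW : IsBrownianMotion W P) (h : TimeL2 d T) :
    hW.wienerMap T h ∈ lpMeas ℝ ℝ (hW.filtration T) 2 P := by
  obtain ⟨φ, hφ⟩ := WienerStep.exists_seq_tendsto h
  refine (hW.isClosed_lpMeas T).mem_of_tendsto (((hW.wienerMap T).continuous.tendsto h).comp hφ)
    (Eventually.of_forall fun k ↦ ?_)
  rw [Function.comp_apply, wienerMap_toTimeL2]
  exact Submodule.sum_mem _ fun j _ ↦ Submodule.sum_mem _ fun i _ ↦ Submodule.smul_mem _ _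
    (Submodule.sub_mem _ (hW.evalLp_mem_lpMeas i ((φ k).le _))
      (hW.evalLp_mem_lpMeas i ((φ k).le _)))

lemma memLp_stochExp (hW : IsBrownianMotion W P) (h : TimeL2 d T) :
    MemLp (stochExp h (hW.wienerMap T h)) 2 P := by
  have := (hW.memLp_exp_wienerMap h).mul_const
    (Real.exp (1 / 2 * ∫ s in Set.Icc (0 : ℝ) T, ‖h s‖ ^ 2))⁻¹
  refine this.ae_eq (Eventually.of_forall fun ω ↦ ?_)
  simp only [stochExp, Real.exp_sub, div_eq_mul_inv]

lemma stochExpSet_subset_lpMeas (hW : IsBrownianMotion W P) :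
    stochExpSet W P T ⊆ (lpMeas ℝ ℝ (hW.filtration T) 2 P : Set (Lp ℝ 2 P)) := by
  rintro X ⟨h, I, hI, hX⟩
  obtain rfl := hW.isWienerIntegral_iff.1 hI
  refine AEStronglyMeasurable.congr ?_ hX.symm
  have := mem_lpMeas_iff_aestronglyMeasurable.1 (hW.wienerMap_mem_lpMeas h)
  exact Real.continuous_exp.comp_aestronglyMeasurable
    (this.sub aestronglyMeasurable_const)

end IsBrownianMotion

/-- Two finite measures under which all the finite-dimensional linear functionals of a process have
the same everywhere finite moment-generating functions give the same law to the process. -/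
lemma MeasureTheory.Measure.map_process_eq_of_mgf_eq {Ω ι E : Type*} [MeasurableSpace Ω]
    [NormedAddCommGroup E] [NormedSpace ℝ E] [CompleteSpace E] [SecondCountableTopology E]
    [MeasurableSpace E] [BorelSpace E] {μ ν : Measure Ω} [IsFiniteMeasure μ] [IsFiniteMeasure ν]
    {V : ι → Ω → E} (hV : ∀ t, Measurable (V t))
    (hint : ∀ (J : Finset ι) (L : StrongDual ℝ (J → E)),
      Integrable (fun ω ↦ Real.exp (L fun t ↦ V t ω)) μ)
    (hmgf : ∀ (J : Finset ι) (L : StrongDual ℝ (J → E)),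
      ∫ ω, Real.exp (L fun t ↦ V t ω) ∂μ = ∫ ω, Real.exp (L fun t ↦ V t ω) ∂ν) :
    μ.map (fun ω t ↦ V t ω) = ν.map (fun ω t ↦ V t ω) := by
  have hVm : Measurable fun ω t ↦ V t ω := measurable_pi_lambda _ hV
  -- The zero functional compares the total masses.
  have hzero : μ = 0 ↔ ν = 0 := by
    have := hmgf ∅ 0
    simp only [zero_apply, Real.exp_zero, integral_const, smul_eq_mul, mul_one] at this
    rw [← Measure.measure_univ_eq_zero, ← measureReal_eq_zero_iff, this, measureReal_eq_zero_iff,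
      Measure.measure_univ_eq_zero]
  refine IsProjectiveLimit.unique
    (P := fun J : Finset ι ↦ (μ.map fun ω t ↦ V t ω).map J.restrict) (fun J ↦ rfl) fun J ↦ ?_
  refine Measure.ext_of_charFunDual (funext fun L ↦ ?_)
  have hJm : Measurable (J.restrict : (ι → E) → J → E) := Finset.measurable_restrict J
  dsimp only
  rw [Measure.map_map hJm hVm, Measure.map_map hJm hVm, charFunDual_apply, charFunDual_apply,
    integral_map (hJm.comp hVm).aemeasurable (by fun_prop),
    integral_map (hJm.comp hVm).aemeasurable (by fun_prop)]
  have huniv : integrableExpSet (fun ω ↦ L fun t ↦ V t ω) μ = Set.univ :=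
    Set.eq_univ_of_forall fun u ↦ hint J (u • L)
  have := eqOn_complexMGF_of_mgf' (X := fun ω ↦ L fun t ↦ V t ω) (Y := fun ω ↦ L fun t ↦ V t ω)
    (funext fun u ↦ hmgf J (u • L)) hzero
  -- The complex moment-generating functions agree on all of `ℂ`; at `i` they are the characteristic
  -- functions.
  have h2 := this (x := Complex.I) (by simp [huniv])
  simp only [complexMGF, mul_comm Complex.I] at h2
  exact h2.symm

/-! ### Totality of the stochastic exponentials. -/

namespace IsBrownianMotion

variable {Ω : Type*} [MeasurableSpace Ω] {P : Measure Ω} {d : ℕ}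
  {W : ℝ≥0 → Ω → EuclideanSpace ℝ (Fin d)} [IsProbabilityMeasure P] {T : ℝ≥0}

/-- Every linear functional of finitely many values of a Brownian motion is a Wiener integral. -/
lemma exists_wienerMap_eq_dual (hW : IsBrownianMotion W P) (J : Finset (Set.Iic T))
    (L : StrongDual ℝ (J → EuclideanSpace ℝ (Fin d))) :
    ∃ h : TimeL2 d T, hW.wienerMap T h =ᵐ[P] fun ω ↦ L fun t ↦ W t ω := by
  classical
  let c : J × Fin d → ℝ := fun p ↦ L (Pi.single p.1 (EuclideanSpace.single p.2 1))
  have hL : ∀ x, L x = ∑ p, c p * x p.1 p.2 := by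
    intro x
    have hx : x = ∑ p : J × Fin d,
        x p.1 p.2 • Pi.single p.1 (EuclideanSpace.single p.2 (1 : ℝ)) := by
      ext t i
      rw [Fintype.sum_prod_type, Finset.sum_apply, Finset.sum_eq_single t]
      · simp [Finset.sum_apply, Pi.single_apply]
      · intro s _ hs
        simp [Finset.sum_apply, Pi.single_eq_of_ne hs.symm]
      · simp
    conv_lhs => rw [hx]
    simp only [map_sum, map_smul, smul_eq_mul, c, mul_comm]
  refine ⟨∑ p : J × Fin d, c p • TimeL2.atom T p.2 (p.1 : Set.Iic T), ?_⟩
  simp only [map_sum, map_smul, hW.wienerMap_atom _ (Subtype.prop (_ : Set.Iic T))]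
  have h1 : ∀ᵐ ω ∂P, ∀ p : J × Fin d,
      (c p • hW.evalLp p.2 (p.1 : Set.Iic T) : Lp ℝ 2 P) ω = c p * W (p.1 : Set.Iic T) ω p.2 := by
    refine ae_all_iff.2 fun p ↦ ?_
    filter_upwards [Lp.coeFn_smul (c p) (hW.evalLp p.2 (p.1 : Set.Iic T)),
      hW.evalLp_coeFn p.2 (p.1 : Set.Iic T)] with ω h1 h2
    simp [h1, h2]
  filter_upwards [Lp.coeFn_fun_finsetSum Finset.univ
    fun p : J × Fin d ↦ c p • hW.evalLp p.2 (p.1 : Set.Iic T), h1] with ω h2 h1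
  rw [h2, hL]
  exact Finset.sum_congr rfl fun p _ ↦ h1 p

/-- The normalising factor is a nonzero constant and can be dropped. -/
lemma integral_mul_exp_wienerMap_eq_zero (hW : IsBrownianMotion W P) {Y : Lp ℝ 2 P}
    (hY : ∀ X ∈ stochExpSet W P T, inner ℝ X Y = 0) (h : TimeL2 d T) :
    ∫ ω, Y ω * Real.exp (hW.wienerMap T h ω) ∂P = 0 := by
  have hX := MemLp.coeFn_toLp (hW.memLp_stochExp h)
  have h0 := hY _ ⟨h, _, hW.isWienerIntegral_iff.2 rfl, hX⟩
  rw [L2.inner_def] at h0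
  have h1 : ∫ ω, Y ω * Real.exp (hW.wienerMap T h ω) *
      (Real.exp (1 / 2 * ∫ s in Set.Icc (0 : ℝ) T, ‖h s‖ ^ 2))⁻¹ ∂P = 0 := by
    refine (integral_congr_ae ?_).trans h0
    filter_upwards [hX] with ω hω
    rw [hω, stochExp, Real.exp_sub, div_eq_mul_inv, real_inner_comm, mul_assoc]
    exact mul_comm _ _
  rw [integral_mul_const] at h1
  exact (mul_eq_zero.1 h1).resolve_right (inv_ne_zero (Real.exp_ne_zero _))

/-- An element of `L²(F_T, P)` that is orthogonal to all stochastic exponentials vanishes. -/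
lemma eq_zero_of_orthogonal_stochExpSet (hW : IsBrownianMotion W P) {Y : Lp ℝ 2 P}
    (hYm : Y ∈ lpMeas ℝ ℝ (hW.filtration T) 2 P)
    (hY : ∀ X ∈ stochExpSet W P T, inner ℝ X Y = 0) : Y = 0 := by
  have hY2 : MemLp Y 2 P := Lp.memLp Y
  have hYi : Integrable Y P := hY2.integrable one_le_two
  have hYp : AEMeasurable (fun ω ↦ ENNReal.ofReal (Y ω)) P := hYi.aemeasurable.ennreal_ofReal
  have hYn : AEMeasurable (fun ω ↦ ENNReal.ofReal (-Y ω)) P := hYi.aemeasurable.neg.ennreal_ofReal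
  have hfin (f : Ω → ℝ) : ∀ᵐ ω ∂P, ENNReal.ofReal (f ω) < ∞ :=
    Eventually.of_forall fun _ ↦ ENNReal.ofReal_lt_top
  have := isFiniteMeasure_withDensity_ofReal hYi.2
  have := isFiniteMeasure_withDensity_ofReal hYi.neg.2
  have hVm : Measurable fun ω (t : Set.Iic T) ↦ W t ω :=
    measurable_pi_lambda _ fun t ↦ hW.measurable t
  have hexp (J : Finset (Set.Iic T)) (L : StrongDual ℝ (J → EuclideanSpace ℝ (Fin d))) :
      MemLp (fun ω ↦ Real.exp (L fun t ↦ W t ω)) 2 P ∧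
        ∫ ω, Y ω * Real.exp (L fun t ↦ W t ω) ∂P = 0 := by
    obtain ⟨h, hh⟩ := hW.exists_wienerMap_eq_dual J L
    constructor
    · refine (hW.memLp_exp_wienerMap h).ae_eq ?_
      filter_upwards [hh] with ω hω
      rw [hω]
    · rw [← hW.integral_mul_exp_wienerMap_eq_zero hY h]
      refine integral_congr_ae ?_
      filter_upwards [hh] with ω hω
      rw [hω]
  have hlaw := Measure.map_process_eq_of_mgf_eq
    (μ := P.withDensity fun ω ↦ ENNReal.ofReal (Y ω))
    (ν := P.withDensity fun ω ↦ ENNReal.ofReal (-Y ω))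
    (V := fun (t : Set.Iic T) ↦ W t) (fun t ↦ hW.measurable t)
    (fun J L ↦ by
      rw [integrable_withDensity_iff_integrable_smul₀' hYp (hfin _)]
      simp only [ENNReal.toReal_ofReal', smul_eq_mul]
      exact hY2.pos_part.integrable_mul (hexp J L).1)
    (fun J L ↦ by
      obtain ⟨h1, h2⟩ := hexp J L
      rw [integral_withDensity_eq_integral_toReal_smul₀ hYp (hfin _),
        integral_withDensity_eq_integral_toReal_smul₀ hYn (hfin _), ← sub_eq_zero]
      simp only [ENNReal.toReal_ofReal', smul_eq_mul]
      refine (integral_sub (hY2.pos_part.integrable_mul h1)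
        (hY2.neg_part.integrable_mul h1)).symm.trans (Eq.trans ?_ h2)
      refine integral_congr_ae (Eventually.of_forall fun ω ↦ ?_)
      simp only [Pi.mul_apply, ← sub_mul, max_zero_sub_max_neg_zero_eq_self])
  rw [Lp.eq_zero_iff_ae_eq_zero]
  refine Lp.ae_eq_zero_of_forall_setIntegral_eq_zero' ℝ (hW.filtration.le T) Y two_ne_zero
    ENNReal.ofNat_ne_top (fun s _ _ ↦ hYi.integrableOn) (fun s hs _ ↦ ?_)
    (mem_lpMeas_iff_aestronglyMeasurable.1 hYm)
  have hsm : MeasurableSet s := hW.filtration.le T s hs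
  -- Sets of `F_T` are preimages under the path map, where the two laws agree.
  obtain ⟨B, hB, rfl⟩ := hW.filtration_le_comap T s hs
  have hBeq := congrArg (fun m ↦ m B) hlaw
  simp only [Measure.map_apply hVm hB, withDensity_apply _ hsm] at hBeq
  rw [integral_eq_lintegral_pos_part_sub_lintegral_neg_part hYi.integrableOn, hBeq, sub_self]

end IsBrownianMotion

/-- The stochastic exponentials of Wiener integrals are well defined, and their linear span is
dense in `L²(F_T, P)`, where `F_T = σ(W s, s ≤ T)`; here `L²(F_T, P)` is the subspace of `L²(P)`
of the classes that have an `F_T`-measurable representative. -/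
theorem mainTheorem9 {Ω : Type*} [MeasurableSpace Ω] (P : Measure Ω) [IsProbabilityMeasure P]
    {d : ℕ} (W : ℝ≥0 → Ω → EuclideanSpace ℝ (Fin d)) (hW : IsBrownianMotion W P) (T : ℝ≥0) :
    (∀ h : TimeL2 d T, ∃! I : Lp ℝ 2 P, IsWienerIntegral W P h I) ∧
    (∀ (h : TimeL2 d T) (I : Lp ℝ 2 P), IsWienerIntegral W P h I → MemLp (stochExp h I) 2 P) ∧
    stochExpSet W P T ⊆ (lpMeas ℝ ℝ (hW.filtration T) 2 P : Set (Lp ℝ 2 P)) ∧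
    (Submodule.span ℝ (stochExpSet W P T)).topologicalClosure =
      lpMeas ℝ ℝ (hW.filtration T) 2 P := by
  refine ⟨fun h ↦ ?_, fun h I hI ↦ ?_, hW.stochExpSet_subset_lpMeas, ?_⟩
  · simp only [hW.isWienerIntegral_iff]
    exact ⟨_, rfl, fun _ h ↦ h⟩
  · obtain rfl := hW.isWienerIntegral_iff.1 hI
    exact hW.memLp_stochExp h
  · set K := (Submodule.span ℝ (stochExpSet W P T)).topologicalClosure with hK
    have hle : K ≤ lpMeas ℝ ℝ (hW.filtration T) 2 P :=
      Submodule.topologicalClosure_minimal _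
        (Submodule.span_le.2 hW.stochExpSet_subset_lpMeas) (hW.isClosed_lpMeas T)
    have : CompleteSpace K :=
      (Submodule.isClosed_topologicalClosure _).completeSpace_coe
    -- It remains to see that the orthogonal complement of `K` inside `L²(F_T)` is trivial.
    rw [← Submodule.sup_orthogonal_inf_of_hasOrthogonalProjection hle, left_eq_sup]
    rintro Y ⟨hY, hYm⟩
    have : Y = 0 := hW.eq_zero_of_orthogonal_stochExpSet hYm fun X hX ↦
      (Submodule.mem_orthogonal _ _).1 hY X
        (Submodule.le_topologicalClosure _ (Submodule.subset_span hX))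
    exact this ▸ K.zero_mem
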